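/- Let $n\ge 1$ and let $U(n)$ be the group of unitary $n\times n$ complex matrices, acting by conjugation, $g\cdot\rho=g\rho g^{-1}$, on the set of density matrices, i.e. positive semidefinite complex $n\times n$ matrices of trace one. Let $\rho$ be a density matrix whose distinct eigenvalues are $\lambda_1,\dots,\lambda_r$ ($r\ge1$), and let $n_i$ be the geometric multiplicity of $\lambda_i$. Then $n_1+\cdots+n_r=n$, and the orbit $\{g\rho g^{-1} : g\in U(n)\}$, with the subspace topology, is homeomorphic to the flag manifold $$U(n)/[U(n_1)\times U(n_2)\times\cdots\times U(n_r)],$$ the space of left cosets, with the quotient topology, of the subgroup of block-diagonal matrices $\mathrm{diag}(u_1,\dots,u_r)$ with $u_i\in U(n_i)$. This flag manifold, with its quotient smooth structure (a real function on it is smooth if and only if its pullback to $U(n)$ is smooth), is a smooth manifold of real dimension $n^2-\sum_{i=1}^r n_i^2$. -/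

import Mathlib

open scoped ComplexOrder Manifold ContDiff

/-- Density matrices of an `n`-level system: positive semidefinite (in particular Hermitian)
complex `n × n` matrices of trace one. -/
def DensityMatrix (n : ℕ) : Type :=
  {ρ : Matrix (Fin n) (Fin n) ℂ // ρ.PosSemidef ∧ ρ.trace = 1}

namespace DensityMatrix

variable {n : ℕ}

/-- The underlying matrix of a density matrix. -/
def toMatrix (ρ : DensityMatrix n) : Matrix (Fin n) (Fin n) ℂ := ρ.1

/-- The topology on density matrices is the subspace topology of the space of matrices. -/
instance : TopologicalSpace (DensityMatrix n) :=
  inferInstanceAs (TopologicalSpace {ρ : Matrix (Fin n) (Fin n) ℂ // ρ.PosSemidef ∧ ρ.trace = 1})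

/-- The conjugate `U ρ U⁻¹` of a density matrix by a unitary matrix. -/
def conj (U : Matrix.unitaryGroup (Fin n) ℂ) (ρ : DensityMatrix n) : DensityMatrix n :=
  ⟨(U : Matrix (Fin n) (Fin n) ℂ) * ρ.toMatrix *
      ((U⁻¹ : Matrix.unitaryGroup (Fin n) ℂ) : Matrix (Fin n) (Fin n) ℂ),
    by
      constructor
      · rw [Matrix.UnitaryGroup.inv_val, Matrix.star_eq_conjTranspose]
        exact ρ.2.1.mul_mul_conjTranspose_same _
      · rw [Matrix.trace_mul_comm, ← mul_assoc, ← Matrix.UnitaryGroup.mul_val, inv_mul_cancel,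
          Matrix.UnitaryGroup.one_val, one_mul]
        exact ρ.2.2⟩

/-- `U(n)` acts on density matrices by conjugation. -/
instance : MulAction (Matrix.unitaryGroup (Fin n) ℂ) (DensityMatrix n) where
  smul := conj
  one_smul ρ := Subtype.ext <| by
    change ((1 : Matrix.unitaryGroup (Fin n) ℂ) : Matrix (Fin n) (Fin n) ℂ) * ρ.1 *
      (((1 : Matrix.unitaryGroup (Fin n) ℂ)⁻¹ : Matrix.unitaryGroup (Fin n) ℂ) :
        Matrix (Fin n) (Fin n) ℂ) = ρ.1
    rw [inv_one, Matrix.UnitaryGroup.one_val, one_mul, mul_one]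
  mul_smul U W ρ := Subtype.ext <| by
    change ((U * W : Matrix.unitaryGroup (Fin n) ℂ) : Matrix (Fin n) (Fin n) ℂ) * ρ.1 *
      (((U * W)⁻¹ : Matrix.unitaryGroup (Fin n) ℂ) : Matrix (Fin n) (Fin n) ℂ) =
      (U : Matrix (Fin n) (Fin n) ℂ) * ((W : Matrix (Fin n) (Fin n) ℂ) * ρ.1 *
        ((W⁻¹ : Matrix.unitaryGroup (Fin n) ℂ) : Matrix (Fin n) (Fin n) ℂ)) *
        ((U⁻¹ : Matrix.unitaryGroup (Fin n) ℂ) : Matrix (Fin n) (Fin n) ℂ)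
    rw [mul_inv_rev, Matrix.UnitaryGroup.mul_val, Matrix.UnitaryGroup.mul_val]
    simp only [mul_assoc]

end DensityMatrix

/-- For `m₁ + ⋯ + m_r = n`, the block-diagonal embedding
`U(m₁) × ⋯ × U(m_r) → U(n)`, `(u₁, …, u_r) ↦ diag(u₁, …, u_r)`, with the blocks in order along
the diagonal. -/
def blockUnitary {n r : ℕ} (m : Fin r → ℕ) (h : ∑ i, m i = n) :
    (∀ i, Matrix.unitaryGroup (Fin (m i)) ℂ) →* Matrix.unitaryGroup (Fin n) ℂ where
  toFun u :=
    ⟨Matrix.reindex (finSigmaFinEquiv.trans (finCongr h)) (finSigmaFinEquiv.trans (finCongr h))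
        (Matrix.blockDiagonal' fun i => (u i : Matrix (Fin (m i)) (Fin (m i)) ℂ)),
      by
        rw [Matrix.mem_unitaryGroup_iff, Matrix.star_eq_conjTranspose, Matrix.conjTranspose_reindex,
          Matrix.blockDiagonal'_conjTranspose, Matrix.reindex_apply, Matrix.reindex_apply,
          Matrix.submatrix_mul_equiv, ← Matrix.blockDiagonal'_mul]
        have key : (fun i => (u i : Matrix (Fin (m i)) (Fin (m i)) ℂ) *
            (u i : Matrix (Fin (m i)) (Fin (m i)) ℂ).conjTranspose) = 1 := by
          funext i
          exact Matrix.mem_unitaryGroup_iff.1 (u i).2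
        rw [key, Matrix.blockDiagonal'_one, Matrix.submatrix_one_equiv]⟩
  map_one' := Subtype.ext <| by
    change Matrix.reindex _ _ (Matrix.blockDiagonal' (1 : ∀ i, Matrix (Fin (m i)) (Fin (m i)) ℂ)) = 1
    rw [Matrix.blockDiagonal'_one, Matrix.reindex_apply, Matrix.submatrix_one_equiv]
  map_mul' u v := Subtype.ext <| by
    change Matrix.reindex _ _ (Matrix.blockDiagonal' fun i =>
        (u i : Matrix (Fin (m i)) (Fin (m i)) ℂ) * (v i : Matrix (Fin (m i)) (Fin (m i)) ℂ)) =
      Matrix.reindex _ _ (Matrix.blockDiagonal' _) * Matrix.reindex _ _ (Matrix.blockDiagonal' _)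
    rw [Matrix.blockDiagonal'_mul, Matrix.reindex_apply, Matrix.reindex_apply,
      Matrix.reindex_apply, Matrix.submatrix_mul_equiv]

/-- The flag manifold `U(n) / [U(m₁) × ⋯ × U(m_r)]`, where `m₁ + ⋯ + m_r = n`: the space of left
cosets of the block-diagonal subgroup. It carries the quotient topology. -/
abbrev FlagManifold {n r : ℕ} (m : Fin r → ℕ) (h : ∑ i, m i = n) : Type :=
  Matrix.unitaryGroup (Fin n) ℂ ⧸ (blockUnitary m h).range

section Smooth

attribute [local instance] Matrix.linftyOpNormedAddCommGroup Matrix.linftyOpNormedSpace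

/-- A real function on the submanifold `U(n)` of the space of complex matrices is smooth if, near
each point of `U(n)`, it is the restriction of a `C^∞` function (in the real sense) defined on an
open set of matrices. (The choice of norm on matrices is irrelevant.) -/
def SmoothOnUnitaryGroup {n : ℕ} (F : Matrix.unitaryGroup (Fin n) ℂ → ℝ) : Prop :=
  ∀ g : Matrix.unitaryGroup (Fin n) ℂ, ∃ O : Set (Matrix (Fin n) (Fin n) ℂ),
    IsOpen O ∧ (g : Matrix (Fin n) (Fin n) ℂ) ∈ O ∧
      ∃ Φ : Matrix (Fin n) (Fin n) ℂ → ℝ, ContDiffOn ℝ ∞ Φ O ∧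
        ∀ u : Matrix.unitaryGroup (Fin n) ℂ, (u : Matrix (Fin n) (Fin n) ℂ) ∈ O → F u = Φ u

end Smooth

/-- The homogeneous space `U(n) / H` is a smooth manifold of real dimension `d`: it is Hausdorff and
second countable, and it has an atlas of charts in `ℝ^d` with `C^∞` transition maps which gives
the quotient smooth structure, i.e. a real function on `U(n) / H` is smooth exactly if its pullback
to `U(n)` is smooth. -/
def IsQuotientManifoldOfDim {n : ℕ} (H : Subgroup (Matrix.unitaryGroup (Fin n) ℂ)) (d : ℕ) : Prop :=
  T2Space (Matrix.unitaryGroup (Fin n) ℂ ⧸ H) ∧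
  SecondCountableTopology (Matrix.unitaryGroup (Fin n) ℂ ⧸ H) ∧
  ∃ _ : ChartedSpace (EuclideanSpace ℝ (Fin d)) (Matrix.unitaryGroup (Fin n) ℂ ⧸ H),
    IsManifold (𝓡 d) ∞ (Matrix.unitaryGroup (Fin n) ℂ ⧸ H) ∧
    ∀ f : Matrix.unitaryGroup (Fin n) ℂ ⧸ H → ℝ,
      ContMDiff (𝓡 d) 𝓘(ℝ, ℝ) ∞ f ↔
        SmoothOnUnitaryGroup fun u : Matrix.unitaryGroup (Fin n) ℂ => f (QuotientGroup.mk u)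

/-! By the spectral theorem `ρ` is unitarily conjugate to a real diagonal matrix `D`, constant on
blocks of sizes `m i` with distinct values. The stabilizer of `D` is then the block-diagonal
subgroup `H` (`mem_range_blockUnitary_iff`), so `u H ↦ u D u*` is a continuous injection from a
compact space into the matrices. It is therefore a closed embedding, and its image is the orbit of
`ρ`. This gives the homeomorphism, and also the Hausdorff property and second countability of the
quotient.

For the smooth structure one chart at the base point suffices, since its translates form an atlas.
It comes from the inverse function theorem applied to `conjExp`, where `q` projects onto the
commutant of `D` and `p` onto the complement. The point is that conjugates of `D` near `D` arise
only from skew-adjoint `z` with `q z = 0`. A star symmetry (`conjExp_star`) makes `p z`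
skew-adjoint, and `D + q z` is then a conjugate of `D` commuting with `D`, hence equal to `D`
because such conjugates are isolated (`eventually_eq_diagonal_of_commute`). The dimension counts the
ordered pairs of indices in different blocks. -/

/-! ### Smooth structure on `U / H` from one chart at the base point -/

/-- A smooth chart, around the base point, of the homogeneous space `U / H` of the unitary group
`U` of a normed `*`-algebra: its inverse lifts to a smooth map into the algebra, and it extends to a
smooth map on an open subset of the algebra. -/
structure BasePointChart {𝔸 : Type*} [NormedRing 𝔸] [NormedAlgebra ℝ 𝔸] [StarRing 𝔸]
    (H : Subgroup (unitary 𝔸)) (E : Type*) [NormedAddCommGroup E] [NormedSpace ℝ E] where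
  /-- The chart. -/
  chart : OpenPartialHomeomorph (unitary 𝔸 ⧸ H) E
  one_mem : (QuotientGroup.mk 1 : unitary 𝔸 ⧸ H) ∈ chart.source
  /-- The lift of the inverse of the chart. -/
  lift : E → unitary 𝔸
  contDiff_lift : ContDiff ℝ ∞ fun x => (lift x : 𝔸)
  chart_symm : ∀ x ∈ chart.target, chart.symm x = QuotientGroup.mk (lift x)
  /-- The open set on which the pullback of the chart extends. -/
  dom : Set 𝔸
  isOpen_dom : IsOpen dom
  mem_dom : ∀ u : unitary 𝔸, (u : 𝔸) ∈ dom ↔ QuotientGroup.mk u ∈ chart.source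
  /-- The extension of the pullback of the chart. -/
  ext : 𝔸 → E
  contDiffOn_ext : ContDiffOn ℝ ∞ ext dom
  chart_mk : ∀ u : unitary 𝔸, (u : 𝔸) ∈ dom → chart (QuotientGroup.mk u) = ext u

namespace BasePointChart

variable {𝔸 : Type*} [NormedRing 𝔸] [NormedAlgebra ℝ 𝔸] [StarRing 𝔸]
  {H : Subgroup (unitary 𝔸)} {E : Type*} [NormedAddCommGroup E] [NormedSpace ℝ E]

/-- The translate of a chart at the base point by `g`. -/
noncomputable def translate (c : BasePointChart H E) (g : unitary 𝔸) :
    OpenPartialHomeomorph (unitary 𝔸 ⧸ H) E :=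
  (Homeomorph.smul g⁻¹).transOpenPartialHomeomorph c.chart

theorem mem_translate_source (c : BasePointChart H E) (g u : unitary 𝔸) :
    (QuotientGroup.mk u : unitary 𝔸 ⧸ H) ∈ (c.translate g).source ↔
      ((g⁻¹ * u : unitary 𝔸) : 𝔸) ∈ c.dom := by
  rw [c.mem_dom]
  rfl

theorem translate_mk (c : BasePointChart H E) (g u : unitary 𝔸)
    (hu : ((g⁻¹ * u : unitary 𝔸) : 𝔸) ∈ c.dom) :
    c.translate g (QuotientGroup.mk u) = c.ext ((g⁻¹ * u : unitary 𝔸) : 𝔸) := by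
  rw [← c.chart_mk _ hu]
  rfl

theorem translate_symm (c : BasePointChart H E) (g : unitary 𝔸) {x : E}
    (hx : x ∈ c.chart.target) :
    (c.translate g).symm x = QuotientGroup.mk (g * c.lift x) := by
  change (Homeomorph.smul g⁻¹).symm (c.chart.symm x) = _
  rw [c.chart_symm x hx, Homeomorph.smul_symm, inv_inv]
  rfl

/-- The translates of a chart at the base point form an atlas. -/
@[reducible] noncomputable def chartedSpace (c : BasePointChart H E) :
    ChartedSpace E (unitary 𝔸 ⧸ H) where
  atlas := Set.range c.translate
  chartAt q := c.translate q.out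
  mem_chart_source q := by
    have h : (QuotientGroup.mk q.out : unitary 𝔸 ⧸ H) ∈ (c.translate q.out).source := by
      rw [mem_translate_source, inv_mul_cancel, c.mem_dom]
      exact c.one_mem
    rwa [QuotientGroup.out_eq'] at h
  chart_mem_atlas q := ⟨_, rfl⟩

/-- The transition maps are `x ↦ ext (g'⁻¹ g · lift x)`: lift to the algebra, multiply by a
constant, apply the extended chart. Each step is smooth between normed spaces, so no manifold
structure on the unitary group is needed. -/
theorem isManifold (c : BasePointChart H E) :
    let := c.chartedSpace
    IsManifold 𝓘(ℝ, E) ∞ (unitary 𝔸 ⧸ H) := by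
  let := c.chartedSpace
  refine isManifold_of_contDiffOn _ _ _ ?_
  rintro _ _ ⟨g, rfl⟩ ⟨g', rfl⟩
  have key : ∀ x ∈ ((c.translate g).symm ≫ₕ c.translate g').source,
      x ∈ c.chart.target ∧ ((g'⁻¹ * (g * c.lift x) : unitary 𝔸) : 𝔸) ∈ c.dom := by
    intro x hx
    rw [OpenPartialHomeomorph.trans_source] at hx
    have h1 : x ∈ c.chart.target := hx.1
    have h2 := hx.2
    rw [Set.mem_preimage, c.translate_symm g h1, mem_translate_source] at h2
    exact ⟨h1, h2⟩
  have hs : ContDiffOn ℝ ∞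
      (fun x => c.ext ((g'⁻¹ : unitary 𝔸) * ((g : 𝔸) * c.lift x)))
      ((c.translate g).symm ≫ₕ c.translate g').source :=
    c.contDiffOn_ext.comp
      (contDiff_const.mul (contDiff_const.mul c.contDiff_lift)).contDiffOn fun x hx => (key x hx).2
  simp only [modelWithCornersSelf_coe, modelWithCornersSelf_coe_symm, Function.id_comp,
    Function.comp_id, Set.preimage_id, Set.range_id, Set.inter_univ]
  refine hs.congr fun x hx => ?_
  obtain ⟨h1, h2⟩ := key x hx
  rw [OpenPartialHomeomorph.coe_trans, Function.comp_apply, c.translate_symm g h1,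
    c.translate_mk _ _ h2]
  rfl

/-- For the smooth structure given by a chart at the base point, a function on `U / H` is smooth if
and only if its pullback to `U` locally extends to smooth functions on the algebra. -/
theorem contMDiff_iff_pullback (c : BasePointChart H E) (f : unitary 𝔸 ⧸ H → ℝ) :
    let := c.chartedSpace
    ContMDiff 𝓘(ℝ, E) 𝓘(ℝ, ℝ) ∞ f ↔
      ∀ g : unitary 𝔸, ∃ O : Set 𝔸, IsOpen O ∧ (g : 𝔸) ∈ O ∧
        ∃ Φ : 𝔸 → ℝ, ContDiffOn ℝ ∞ Φ O ∧
          ∀ u : unitary 𝔸, (u : 𝔸) ∈ O → f (QuotientGroup.mk u) = Φ u := by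
  let := c.chartedSpace
  have := c.isManifold
  constructor
  · intro hf g
    let q : unitary 𝔸 ⧸ H := QuotientGroup.mk g
    -- The preferred chart at `q` is translated by the chosen representative `k`, which may differ
    -- from `g`.
    let k : unitary 𝔸 := q.out
    have hsm : ContDiffOn ℝ ∞ (f ∘ (c.translate k).symm) c.chart.target := by
      have h1 := hf.comp_contMDiffOn (contMDiffOn_extChartAt_symm (I := 𝓘(ℝ, E)) (n := ∞) q)
      rw [contMDiffOn_iff_contDiffOn] at h1
      have h2 : (extChartAt 𝓘(ℝ, E) q).target = c.chart.target := by
        rw [extChartAt_target]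
        rw [modelWithCornersSelf_coe_symm, Set.preimage_id, ModelWithCorners.range_eq_univ,
          Set.inter_univ]
        rfl
      rw [h2] at h1
      exact h1
    have hmul : ContDiff ℝ ∞ fun X : 𝔸 => ((k⁻¹ : unitary 𝔸) : 𝔸) * X :=
      contDiff_const.mul contDiff_id
    have hext : ContDiffOn ℝ ∞ (fun X : 𝔸 => c.ext (((k⁻¹ : unitary 𝔸) : 𝔸) * X))
        ((fun X : 𝔸 => ((k⁻¹ : unitary 𝔸) : 𝔸) * X) ⁻¹' c.dom) :=
      c.contDiffOn_ext.comp hmul.contDiffOn fun x hx => hx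
    refine ⟨(fun X : 𝔸 => ((k⁻¹ : unitary 𝔸) : 𝔸) * X) ⁻¹' c.dom ∩
        (fun X : 𝔸 => c.ext (((k⁻¹ : unitary 𝔸) : 𝔸) * X)) ⁻¹' c.chart.target,
      hext.continuousOn.isOpen_inter_preimage (c.isOpen_dom.preimage hmul.continuous)
        c.chart.open_target, ?_,
      fun X => f ((c.translate k).symm (c.ext (((k⁻¹ : unitary 𝔸) : 𝔸) * X))), ?_, ?_⟩
    · have h1 : q ∈ (c.translate k).source := ChartedSpace.mem_chart_source q
      have h2 := (c.mem_translate_source k g).1 h1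
      refine ⟨h2, ?_⟩
      have h3 := (c.translate k).map_source h1
      rw [c.translate_mk k g h2] at h3
      exact h3
    · exact hsm.comp (hext.mono Set.inter_subset_left) fun x hx => hx.2
    · intro u hu
      have h2 : ((k⁻¹ * u : unitary 𝔸) : 𝔸) ∈ c.dom := hu.1
      have h1 := (c.mem_translate_source k u).2 h2
      have h3 := (c.translate k).left_inv h1
      rw [c.translate_mk k u h2] at h3
      exact congrArg f h3.symm
  · intro hf q
    let k : unitary 𝔸 := q.out
    have hq : q ∈ (c.translate k).source := ChartedSpace.mem_chart_source q
    let x₀ := c.translate k q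
    have hx₀ : x₀ ∈ c.chart.target := (c.translate k).map_source hq
    have hlift : ContDiff ℝ ∞ fun x => (k : 𝔸) * c.lift x := contDiff_const.mul c.contDiff_lift
    -- `k * c.lift x₀` represents `q` and lies on the smooth local section `x ↦ k * c.lift x`. Along
    -- that section `f` in the chart becomes `Φ` composed with a smooth map.
    obtain ⟨O, hO, hmem, Φ, hΦ, hfΦ⟩ := hf (k * c.lift x₀)
    have hev : ∀ᶠ x in nhds x₀, f ((c.translate k).symm x) = Φ ((k : 𝔸) * c.lift x) := by
      filter_upwards [c.chart.open_target.mem_nhds hx₀,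
        (hO.preimage hlift.continuous).mem_nhds hmem] with x h1 h2
      rw [c.translate_symm k h1]
      exact hfΦ (k * c.lift x) h2
    have hcd : ContDiffAt ℝ ∞ (f ∘ (c.translate k).symm) x₀ := by
      refine ContDiffAt.congr_of_eventuallyEq ?_ hev
      exact (hΦ.contDiffAt (hO.mem_nhds hmem)).comp x₀ hlift.contDiffAt
    rw [contMDiffAt_iff]
    constructor
    · have h1 : ContinuousAt ((f ∘ (c.translate k).symm) ∘ c.translate k) q :=
        ContinuousAt.comp hcd.continuousAt ((c.translate k).continuousAt hq)
      refine h1.congr ?_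
      filter_upwards [(c.translate k).open_source.mem_nhds hq] with y hy
      exact congrArg f ((c.translate k).left_inv hy)
    · exact hcd.contDiffWithinAt

end BasePointChart

/-! ### The map `conjExp` and its derivative at zero -/

section ConjugationChart

variable {𝔸 : Type*} [NormedRing 𝔸] [NormedAlgebra ℝ 𝔸]

theorem contDiff_normedSpace_exp [CompleteSpace 𝔸] {n : WithTop ℕ∞} :
    ContDiff ℝ n (NormedSpace.exp : 𝔸 → 𝔸) :=
  contDiff_iff_contDiffAt.2 fun x => (NormedSpace.exp_analytic (𝕂 := ℝ) x).contDiffAt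

/-- The map `z ↦ exp(p z) (D + q z) exp(-p z)`. -/
noncomputable def conjExp (p q : 𝔸 →L[ℝ] 𝔸) (D z : 𝔸) : 𝔸 :=
  NormedSpace.exp (p z) * (D + q z) * NormedSpace.exp (-p z)

theorem contDiff_conjExp [CompleteSpace 𝔸] (p q : 𝔸 →L[ℝ] 𝔸) (D : 𝔸) {n : WithTop ℕ∞} :
    ContDiff ℝ n (conjExp p q D) :=
  ((contDiff_normedSpace_exp.comp p.contDiff).mul (contDiff_const.add q.contDiff)).mul
    (contDiff_normedSpace_exp.comp p.contDiff.neg)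

theorem conjExp_zero (p q : 𝔸 →L[ℝ] 𝔸) (D : 𝔸) : conjExp p q D 0 = D := by
  simp [conjExp]

/-- The exponential has derivative the identity at `0`, so the product rule gives the commutator of
`p z` with `D` plus `q z`. -/
theorem hasFDerivAt_conjExp [CompleteSpace 𝔸] (p q : 𝔸 →L[ℝ] 𝔸) (D : 𝔸) {L : 𝔸 →L[ℝ] 𝔸}
    (hL : ∀ z, L z = p z * D - D * p z + q z) :
    HasFDerivAt (conjExp p q D) L 0 := by
  have he : HasFDerivAt (NormedSpace.exp : 𝔸 → 𝔸) (1 : 𝔸 →L[ℝ] 𝔸) (p 0) := by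
    rw [map_zero]
    exact hasStrictFDerivAt_exp_zero.hasFDerivAt
  have he' : HasFDerivAt (NormedSpace.exp : 𝔸 → 𝔸) (1 : 𝔸 →L[ℝ] 𝔸) (-p 0) := by
    rw [map_zero, neg_zero]
    exact hasStrictFDerivAt_exp_zero.hasFDerivAt
  have h1 := he.comp (0 : 𝔸) p.hasFDerivAt
  have h2 := he'.comp (0 : 𝔸) p.hasFDerivAt.neg
  have h3 : HasFDerivAt (fun z => D + q z) q (0 : 𝔸) := q.hasFDerivAt.const_add D
  refine ((h1.mul' h3).mul' h2).congr_fderiv ?_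
  ext z
  simp [hL]
  abel

end ConjugationChart

/-! ### Splittings along a commutant and the local inverse -/

section

variable {𝔸 : Type*} [NormedRing 𝔸] [NormedAlgebra ℝ 𝔸] [StarRing 𝔸]

theorem exp_mem_unitary_of_star_eq_neg [CompleteSpace 𝔸] [ContinuousStar 𝔸] {a : 𝔸} (ha : star a = -a) :
    NormedSpace.exp a ∈ unitary 𝔸 :=
  let := NormedAlgebra.restrictScalars ℚ ℝ 𝔸
  NormedSpace.exp_mem_unitary_of_mem_skewAdjoint (skewAdjoint.mem_iff.2 ha)

theorem exp_neg_eq_star_of_star_eq_neg {𝔸 : Type*} [NormedRing 𝔸] [StarRing 𝔸] [ContinuousStar 𝔸]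
    {a : 𝔸} (ha : star a = -a) :
    NormedSpace.exp (-a) = star (NormedSpace.exp a) := by
  rw [NormedSpace.star_exp, ha]

/-- A splitting of a normed `*`-algebra relative to a self-adjoint element `D`: complementary
projections `q` onto the commutant of `D` and `p` onto a complement on which the commutator with `D`
is invertible, together with linear coordinates on the skew-adjoint part of that complement. -/
structure CommutantSplitting (D : 𝔸) (E : Type*) [NormedAddCommGroup E] [NormedSpace ℝ E] where
  p : 𝔸 →L[ℝ] 𝔸
  q : 𝔸 →L[ℝ] 𝔸
  isSelfAdjoint : star D = D
  add_eq : ∀ z, p z + q z = z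
  p_q : ∀ z, p (q z) = 0
  p_star : ∀ z, p (star z) = star (p z)
  q_star : ∀ z, q (star z) = star (q z)
  commute : ∀ z, Commute (q z) D
  /-- The derivative of `conjExp` at zero. -/
  deriv : 𝔸 ≃L[ℝ] 𝔸
  deriv_apply : ∀ z, deriv z = p z * D - D * p z + q z
  /-- The parametrization of the skew-adjoint elements of the range of `p`. -/
  param : E →L[ℝ] 𝔸
  /-- The coordinates on the skew-adjoint elements of the range of `p`. -/
  coord : 𝔸 →L[ℝ] E
  coord_param : ∀ e, coord (param e) = e
  p_param : ∀ e, p (param e) = param e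
  star_param : ∀ e, star (param e) = -param e
  param_coord : ∀ z, p z = z → star z = -z → param (coord z) = z

namespace CommutantSplitting

variable {D : 𝔸} {E : Type*} [NormedAddCommGroup E] [NormedSpace ℝ E]

theorem q_eq_zero (S : CommutantSplitting D E) {z : 𝔸} (hz : S.p z = z) : S.q z = 0 := by
  have := S.add_eq z
  rwa [hz, add_eq_left] at this

/-- The star reverses the product and replaces `p z` by `-star (p z)` and `q z` by `star (q z)`.
Combined with local injectivity, this forces `p z` to be skew-adjoint whenever the value is
self-adjoint. -/
theorem conjExp_star [ContinuousStar 𝔸] (S : CommutantSplitting D E) (z : 𝔸) :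
    conjExp S.p S.q D (-star (S.p z) + star (S.q z)) = star (conjExp S.p S.q D z) := by
  have hpp : S.p (S.p z) = S.p z := by
    have := congrArg S.p (S.add_eq z)
    rwa [map_add, S.p_q, add_zero] at this
  have hqq : S.q (S.q z) = S.q z := by
    have := S.add_eq (S.q z)
    rwa [S.p_q, zero_add] at this
  have hp : S.p (-star (S.p z) + star (S.q z)) = -star (S.p z) := by
    rw [map_add, map_neg, S.p_star, S.p_star, S.p_q, hpp, star_zero, add_zero]
  have hq : S.q (-star (S.p z) + star (S.q z)) = star (S.q z) := by
    rw [map_add, map_neg, S.q_star, S.q_star, S.q_eq_zero hpp, hqq, star_zero, neg_zero, zero_add]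
  rw [conjExp, conjExp, hp, hq, star_mul, star_mul, NormedSpace.star_exp, NormedSpace.star_exp,
    star_neg, neg_neg, star_add, S.isSelfAdjoint, mul_assoc]

/-- A local inverse of `conjExp` near `D`, on a domain where every self-adjoint value that is
conjugate to `D` is attained at a skew-adjoint point of the range of `p`. -/
theorem exists_localInverse [CompleteSpace 𝔸] [ContinuousStar 𝔸] (S : CommutantSplitting D E)
    (hD : ∀ᶠ W in nhds D, Commute W D → (∃ v : unitary 𝔸, W = v * D * star (v : 𝔸)) → W = D) :
    ∃ φ : OpenPartialHomeomorph 𝔸 𝔸, (∀ z, φ z = conjExp S.p S.q D z) ∧ (0 : 𝔸) ∈ φ.source ∧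
      ContDiffOn ℝ ∞ φ.symm φ.target ∧
      ∀ u : unitary 𝔸, (u : 𝔸) * D * star (u : 𝔸) ∈ φ.target →
        S.p (φ.symm (u * D * star (u : 𝔸))) = φ.symm (u * D * star (u : 𝔸)) ∧
        star (φ.symm (u * D * star (u : 𝔸))) = -φ.symm (u * D * star (u : 𝔸)) := by
  have hd : HasFDerivAt (conjExp S.p S.q D) (S.deriv : 𝔸 →L[ℝ] 𝔸) 0 :=
    hasFDerivAt_conjExp S.p S.q D S.deriv_apply
  -- Analyticity, unlike `C^∞` regularity at a point, passes to a whole neighbourhood; this is used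
  -- below for the inverse.
  have hc : ContDiffAt ℝ ω (conjExp S.p S.q D) 0 := (contDiff_conjExp _ _ _).contDiffAt
  have hn : (ω : WithTop ℕ∞) ≠ 0 := by simp
  let φ := hc.toOpenPartialHomeomorph (conjExp S.p S.q D) hd hn
  have hφ : ∀ z, φ z = conjExp S.p S.q D z := fun z => rfl
  have h0 : (0 : 𝔸) ∈ φ.source := hc.mem_toOpenPartialHomeomorph_source hd hn
  have hφ0 : φ 0 = D := conjExp_zero _ _ _
  have hinv : ContDiffAt ℝ ω φ.symm D := by
    have := hc.to_localInverse hd hn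
    rwa [conjExp_zero] at this
  obtain ⟨T, hT, hTo, hDT⟩ := eventually_nhds_iff.1 (hinv.eventually (by simp))
  obtain ⟨N, hN, hNo, hDN⟩ := eventually_nhds_iff.1 hD
  have hcτ : Continuous fun z => -star (S.p z) + star (S.q z) := by fun_prop
  have hcN : Continuous fun z => D + S.q z := by fun_prop
  -- The three conditions serve in turn for smoothness of the inverse at the value, for injectivity
  -- at the starred point, and for the isolation hypothesis at `D + q z`.
  let s : Set 𝔸 := conjExp S.p S.q D ⁻¹' T ∩ (fun z => -star (S.p z) + star (S.q z)) ⁻¹' φ.source ∩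
    (fun z => D + S.q z) ⁻¹' N
  have hs : IsOpen s := ((hTo.preimage (contDiff_conjExp (n := 0) _ _ _).continuous).inter
    (φ.open_source.preimage hcτ)).inter (hNo.preimage hcN)
  have h0s : (0 : 𝔸) ∈ s := by
    refine ⟨⟨?_, ?_⟩, ?_⟩
    · rw [Set.mem_preimage, conjExp_zero]
      exact hDT
    · simpa using h0
    · simpa using hDN
  let φ' := φ.restrOpen s hs
  have hmem : ∀ X ∈ φ'.target, φ.symm X ∈ φ.source ∧ φ.symm X ∈ s ∧
      conjExp S.p S.q D (φ.symm X) = X := by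
    intro X hX
    have h1 : φ.symm X ∈ φ.source ∩ s := φ'.map_target hX
    exact ⟨h1.1, h1.2, φ'.right_inv hX⟩
  refine ⟨φ', hφ, ⟨h0, h0s⟩, ?_, ?_⟩
  · intro X hX
    obtain ⟨h1, h2, h3⟩ := hmem X hX
    have h4 := h2.1.1
    rw [Set.mem_preimage, h3] at h4
    exact ((hT X h4).of_le (by simp)).contDiffWithinAt
  · intro u hX
    set X := (u : 𝔸) * D * star (u : 𝔸) with hXdef
    obtain ⟨h1, ⟨⟨h4, h5⟩, h6⟩, h3⟩ := hmem X hX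
    change S.p (φ.symm X) = φ.symm X ∧ star (φ.symm X) = -φ.symm X
    set z := φ.symm X with hz
    have hXstar : star X = X := by
      rw [hXdef, star_mul, star_mul, star_star, S.isSelfAdjoint, mul_assoc]
    have hτ : -star (S.p z) + star (S.q z) = z := by
      refine φ.injOn h5 h1 ?_
      rw [hφ, hφ, S.conjExp_star, h3, hXstar]
    have hskew : star (S.p z) = -S.p z := by
      have h := congrArg S.p hτ
      have hpp : S.p (S.p z) = S.p z := by
        have := congrArg S.p (S.add_eq z)
        rwa [map_add, S.p_q, add_zero] at this
      rw [map_add, map_neg, S.p_star, S.p_star, S.p_q, hpp, star_zero, add_zero] at h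
      exact neg_eq_iff_eq_neg.1 h
    -- Undoing the conjugation by `exp (p z)`, now unitary, exhibits `D + q z` as the conjugate of
    -- `D` by `exp (-p z) * u`.
    have hW : D + S.q z = D := by
      refine hN _ h6 ((Commute.refl D).add_left (S.commute z))
        ⟨⟨_, exp_mem_unitary_of_star_eq_neg (a := -S.p z) (by rw [star_neg, hskew])⟩ * u, ?_⟩
      have hunit : NormedSpace.exp (-S.p z) * NormedSpace.exp (S.p z) = 1 := by
        rw [exp_neg_eq_star_of_star_eq_neg hskew]
        exact Unitary.star_mul_self_of_mem (exp_mem_unitary_of_star_eq_neg hskew)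
      have hst : star (NormedSpace.exp (-S.p z)) = NormedSpace.exp (S.p z) := by
        rw [exp_neg_eq_star_of_star_eq_neg hskew, star_star]
      have h7 : NormedSpace.exp (-S.p z) * X * NormedSpace.exp (S.p z) = D + S.q z := by
        rw [← h3, conjExp]
        calc _ = (NormedSpace.exp (-S.p z) * NormedSpace.exp (S.p z)) * (D + S.q z) *
              (NormedSpace.exp (-S.p z) * NormedSpace.exp (S.p z)) := by noncomm_ring
          _ = _ := by rw [hunit, one_mul, mul_one]
      rw [← h7, hXdef, Submonoid.coe_mul, star_mul, hst]
      simp only [mul_assoc]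
    have hpz : S.p z = z := by
      have := S.add_eq z
      rwa [add_eq_left.1 hW, add_zero] at this
    exact ⟨hpz, by rw [← hpz]; exact hskew⟩

end CommutantSplitting

end

/-! ### Embedding of the quotient by a stabilizer as an orbit -/

section ConjMap

variable {𝔸 : Type*} [Ring 𝔸] [StarRing 𝔸]

theorem conj_eq_conj_iff_commute (u v : unitary 𝔸) (D : 𝔸) :
    (u : 𝔸) * D * star (u : 𝔸) = v * D * star (v : 𝔸) ↔ Commute ((u⁻¹ * v : unitary 𝔸) : 𝔸) D := by
  have hu : star (u : 𝔸) * u = 1 := Unitary.coe_star_mul_self u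
  have hu' : (u : 𝔸) * star (u : 𝔸) = 1 := Unitary.coe_mul_star_self u
  have hv : star (v : 𝔸) * v = 1 := Unitary.coe_star_mul_self v
  have hv' : (v : 𝔸) * star (v : 𝔸) = 1 := Unitary.coe_mul_star_self v
  rw [Submonoid.coe_mul, ← Unitary.star_eq_inv, Unitary.coe_star, commute_iff_eq]
  constructor
  · intro h
    calc star (u : 𝔸) * v * D = star (u : 𝔸) * (v * D * star (v : 𝔸)) * v := by
          simp only [mul_assoc, hv, mul_one]
      _ = star (u : 𝔸) * u * D * star (u : 𝔸) * v := by rw [← h]; simp only [mul_assoc]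
      _ = D * (star (u : 𝔸) * v) := by rw [hu, one_mul, mul_assoc]
  · intro h
    calc (u : 𝔸) * D * star (u : 𝔸) = u * (D * (star (u : 𝔸) * v)) * star (v : 𝔸) := by
          simp only [mul_assoc, hv', mul_one]
      _ = u * star (u : 𝔸) * v * D * star (v : 𝔸) := by rw [← h]; simp only [mul_assoc]
      _ = v * D * star (v : 𝔸) := by rw [hu', one_mul]

/-- The map `u H ↦ u D u⁻¹` on the quotient of the unitary group by the stabilizer `H` of `D`. -/
def conjMap {H : Subgroup (unitary 𝔸)} {D : 𝔸} (hH : ∀ u, u ∈ H ↔ Commute (u : 𝔸) D) :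
    unitary 𝔸 ⧸ H → 𝔸 :=
  Quotient.lift (fun u : unitary 𝔸 => (u : 𝔸) * D * star (u : 𝔸)) fun u v h =>
    (conj_eq_conj_iff_commute u v D).2 <| (hH _).1 <| QuotientGroup.leftRel_apply.1 h

variable {H : Subgroup (unitary 𝔸)} {D : 𝔸} (hH : ∀ u, u ∈ H ↔ Commute (u : 𝔸) D)

theorem conjMap_mk (u : unitary 𝔸) :
    conjMap hH (QuotientGroup.mk u) = (u : 𝔸) * D * star (u : 𝔸) := rfl

theorem conjMap_injective : Function.Injective (conjMap hH) := by
  intro x y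
  obtain ⟨u, rfl⟩ := QuotientGroup.mk_surjective x
  obtain ⟨v, rfl⟩ := QuotientGroup.mk_surjective y
  rw [conjMap_mk, conjMap_mk, conj_eq_conj_iff_commute, ← hH, QuotientGroup.eq]
  exact id

theorem continuous_conjMap [TopologicalSpace 𝔸] [ContinuousMul 𝔸] [ContinuousStar 𝔸] :
    Continuous (conjMap hH) :=
  Continuous.quotient_lift (by fun_prop) _

theorem isClosedEmbedding_conjMap [TopologicalSpace 𝔸] [T2Space 𝔸] [ContinuousMul 𝔸]
    [ContinuousStar 𝔸] [CompactSpace (unitary 𝔸)] : Topology.IsClosedEmbedding (conjMap hH) :=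
  (continuous_conjMap hH).isClosedEmbedding (conjMap_injective hH)

end ConjMap

/-! ### The chart at the base point -/

section

variable {𝔸 : Type*} [NormedRing 𝔸] [NormedAlgebra ℝ 𝔸] [StarRing 𝔸] [ContinuousStar 𝔸]
  [StarModule ℝ 𝔸] [CompleteSpace 𝔸] {D : 𝔸} {E : Type*} [NormedAddCommGroup E] [NormedSpace ℝ E]
  {H : Subgroup (unitary 𝔸)}

/-- If `D` is isolated among its unitary conjugates that commute with it, the quotient of the
unitary group by the stabilizer of `D` has a smooth chart at the base point. -/
theorem CommutantSplitting.nonempty_basePointChart (S : CommutantSplitting D E)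
    (hD : ∀ᶠ W in nhds D, Commute W D → (∃ v : unitary 𝔸, W = v * D * star (v : 𝔸)) → W = D)
    (hH : ∀ u, u ∈ H ↔ Commute (u : 𝔸) D) : Nonempty (BasePointChart H E) := by
  obtain ⟨φ, hφ, h0, hsm, hφu⟩ := S.exists_localInverse hD
  let lift : E → unitary 𝔸 := fun e =>
    ⟨NormedSpace.exp (S.param e), exp_mem_unitary_of_star_eq_neg (S.star_param e)⟩
  have hlift : ContDiff ℝ ∞ fun e => (lift e : 𝔸) :=
    contDiff_normedSpace_exp.comp S.param.contDiff
  have hliftc : Continuous lift := hlift.continuous.subtype_mk _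
  have hconj : ∀ z (hz : star z = -z), S.p z = z →
      conjMap hH (QuotientGroup.mk ⟨NormedSpace.exp z, exp_mem_unitary_of_star_eq_neg hz⟩) =
        φ z := by
    intro z hz hpz
    rw [hφ, conjMap_mk, conjExp, hpz, S.q_eq_zero hpz, add_zero, exp_neg_eq_star_of_star_eq_neg hz]
  have hconj' : ∀ e, conjMap hH (QuotientGroup.mk (lift e)) = φ (S.param e) := fun e =>
    hconj _ (S.star_param e) (S.p_param e)
  have hcm : Continuous (conjMap hH) := continuous_conjMap hH
  -- On the orbit the local inverse lands in the skew-adjoint part of the range of `p`, where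
  -- `coord` loses nothing.
  have hpc : ∀ x, conjMap hH x ∈ φ.target →
      S.param (S.coord (φ.symm (conjMap hH x))) = φ.symm (conjMap hH x) := by
    intro x hx
    obtain ⟨u, rfl⟩ := QuotientGroup.mk_surjective x
    obtain ⟨h1, h2⟩ := hφu u hx
    exact S.param_coord _ h1 h2
  let c : OpenPartialHomeomorph (unitary 𝔸 ⧸ H) E :=
    { toFun := fun x => S.coord (φ.symm (conjMap hH x))
      invFun := fun e => QuotientGroup.mk (lift e)
      source := conjMap hH ⁻¹' φ.target
      target := S.param ⁻¹' φ.source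
      map_source' := fun x hx => by
        rw [Set.mem_preimage, hpc x hx]
        exact φ.map_target hx
      map_target' := fun e he => by
        rw [Set.mem_preimage, hconj']
        exact φ.map_source he
      left_inv' := fun x hx => by
        apply conjMap_injective hH
        rw [hconj', hpc x hx]
        exact φ.right_inv hx
      right_inv' := fun e he => by
        rw [hconj', φ.left_inv he, S.coord_param]
      open_source := φ.open_target.preimage hcm
      open_target := φ.open_source.preimage S.param.continuous
      continuousOn_toFun := S.coord.continuous.comp_continuousOn
        (φ.continuousOn_symm.comp hcm.continuousOn fun x hx => hx)
      continuousOn_invFun := (QuotientGroup.continuous_mk.comp hliftc).continuousOn }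
  have hX : ContDiff ℝ ∞ fun X : 𝔸 => X * D * star X :=
    (contDiff_id.mul contDiff_const).mul (starL' ℝ : 𝔸 ≃L[ℝ] 𝔸).contDiff
  exact ⟨
    { chart := c
      one_mem := by
        have h1 : conjMap hH (QuotientGroup.mk 1) = φ 0 := by
          rw [hφ, conjExp_zero, conjMap_mk]
          simp
        change conjMap hH (QuotientGroup.mk 1) ∈ φ.target
        rw [h1]
        exact φ.map_source h0
      lift := lift
      contDiff_lift := hlift
      chart_symm := fun _ _ => rfl
      dom := (fun X => X * D * star X) ⁻¹' φ.target
      isOpen_dom := φ.open_target.preimage hX.continuous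
      mem_dom := fun u => Iff.rfl
      ext := fun X => S.coord (φ.symm (X * D * star X))
      contDiffOn_ext := S.coord.contDiff.comp_contDiffOn
        (hsm.comp hX.contDiffOn fun X hX => hX)
      chart_mk := fun _ _ => rfl }⟩

end

/-! ### Diagonal matrices: isolation, commutant and coordinates -/

section

variable {ι : Type*} [Fintype ι] [DecidableEq ι]

open Polynomial in
/-- A diagonal matrix is isolated among the matrices that commute with it and are conjugate
to it. -/
theorem eventually_eq_diagonal_of_commute (c : ι → ℂ) :
    ∀ᶠ W in nhds (Matrix.diagonal c), Commute W (Matrix.diagonal c) →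
      (∃ v : unitary (Matrix ι ι ℂ), W = v * Matrix.diagonal c * star (v : Matrix ι ι ℂ)) →
        W = Matrix.diagonal c := by
  -- `P` has the distinct diagonal entries as simple roots and annihilates every conjugate of the
  -- diagonal matrix; `q k` omits the root `c k`, so it does not vanish there.
  let q : ι → ℂ[X] := fun k => ∏ z ∈ (Finset.univ.image c).erase (c k), (X - C z)
  let P : ℂ[X] := ∏ z ∈ Finset.univ.image c, (X - C z)
  have hP : ∀ k, P = q k * (X - C (c k)) := fun k =>
    (Finset.prod_erase_mul _ _ (Finset.mem_image_of_mem c (Finset.mem_univ k))).symm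
  have hdiag : ∀ r : ℂ[X], aeval (Matrix.diagonal c) r = Matrix.diagonal fun k => r.eval (c k) := by
    intro r
    have h := aeval_algHom_apply (Matrix.diagonalAlgHom ℂ (n := ι) (α := ℂ)) c r
    rw [Matrix.diagonalAlgHom_apply, Matrix.diagonalAlgHom_apply] at h
    rw [h]
    congr 1
    ext k
    rw [aeval_pi]
    exact congrFun (coe_aeval_eq_eval (c k)) r
  -- Column `k` of `R W` is column `k` of `q k` at `W`. At the diagonal matrix `R` is diagonal with
  -- nonzero entries, so `R W` stays invertible nearby.
  let R : Matrix ι ι ℂ → Matrix ι ι ℂ := fun W => Matrix.of fun i k => aeval W (q k) i k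
  have hR : Continuous R := continuous_matrix fun i k =>
    (Polynomial.continuous_aeval (q k)).matrix_elem i k
  have hRD : (R (Matrix.diagonal c)).det ≠ 0 := by
    have h : R (Matrix.diagonal c) = Matrix.diagonal fun k => (q k).eval (c k) := by
      ext i k
      simp only [R, Matrix.of_apply, hdiag, Matrix.diagonal_apply]
      split_ifs with hik
      · rw [hik]
      · rfl
    rw [h, Matrix.det_diagonal, Finset.prod_ne_zero_iff]
    intro k _
    simp only [q, eval_prod, eval_sub, eval_X, eval_C]
    exact Finset.prod_ne_zero_iff.2 fun z hz => sub_ne_zero.2 (Finset.ne_of_mem_erase hz).symm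
  filter_upwards [(hR.matrix_det).continuousAt.eventually_ne hRD] with W hW hcomm ⟨v, hv⟩
  have hPW : aeval W P = 0 := by
    have h := Polynomial.aeval_algHom_apply
      (Unitary.conjStarAlgAut ℂ (Matrix ι ι ℂ) v).toAlgEquiv.toAlgHom (Matrix.diagonal c) P
    have h0 : aeval (Matrix.diagonal c) P = 0 := by
      rw [hdiag, Matrix.diagonal_eq_zero]
      ext k
      rw [hP k]
      simp
    rw [h0, map_zero] at h
    rw [hv]
    exact h
  -- In column `k`, commutation moves `W - diagonal c` to the right of `q k` at `W`. There the
  -- diagonal matrix acts as the scalar `c k`, which leaves column `k` of `P` at `W`, namely zero.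
  have hzero : (W - Matrix.diagonal c) * R W = 0 := by
    ext i k
    have h1 : ((W - Matrix.diagonal c) * R W) i k = ((W - Matrix.diagonal c) * aeval W (q k)) i k := by
      simp [Matrix.mul_apply, R]
    have h2 : Commute (W - Matrix.diagonal c) (aeval W (q k)) := by
      have h3 : Commute W (W - Matrix.diagonal c) := (Commute.refl W).sub_right hcomm
      induction q k using Polynomial.induction_on' with
      | add a b ha hb => rw [map_add]; exact ha.add_right hb
      | monomial m a =>
        rw [aeval_monomial]
        exact (Algebra.commute_algebraMap_right a _).mul_right (h3.symm.pow_right m)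
    have h4 : (aeval W (q k) * (W - Matrix.diagonal c)) i k = (aeval W P) i k := by
      rw [hP k, map_mul, map_sub, aeval_X, aeval_C, mul_sub, mul_sub, Matrix.sub_apply,
        Matrix.sub_apply, Matrix.mul_diagonal, Matrix.algebraMap_eq_diagonal, Matrix.mul_diagonal]
      rfl
    rw [h1, h2.eq, h4, hPW]
  have hu : IsUnit (R W) := (Matrix.isUnit_iff_isUnit_det _).2 (isUnit_iff_ne_zero.2 hW)
  exact sub_eq_zero.1 (hu.mul_left_eq_zero.1 hzero)

theorem commute_diagonal_iff (c : ι → ℂ) (A : Matrix ι ι ℂ) :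
    Commute A (Matrix.diagonal c) ↔ ∀ i j, c i ≠ c j → A i j = 0 := by
  rw [commute_iff_eq, ← Matrix.ext_iff]
  refine forall₂_congr fun i j => ?_
  rw [Matrix.mul_diagonal, Matrix.diagonal_mul, mul_comm, ← sub_eq_zero, ← sub_mul, mul_eq_zero,
    sub_eq_zero, or_iff_not_imp_left]
  exact imp_congr_left ⟨fun h h' => h h'.symm, fun h h' => h h'.symm⟩

/-- Unitarity is a closed condition and bounds every entry by `1`. -/
instance compactSpace_unitary_matrix : CompactSpace (unitary (Matrix ι ι ℂ)) := by
  refine (isCompact_iff_compactSpace (s := (unitary (Matrix ι ι ℂ) : Set (Matrix ι ι ℂ)))).1 ?_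
  refine IsCompact.of_isClosed_subset
    (isCompact_univ_pi fun _ : ι => isCompact_univ_pi fun _ : ι => isCompact_closedBall (0 : ℂ) 1)
    (isClosed_unitary (R := Matrix ι ι ℂ)) ?_
  intro U hU i _ j _
  rw [mem_closedBall_zero_iff]
  exact entry_norm_bound_of_unitary hU i j

section

attribute [local instance] Matrix.linftyOpNormedRing Matrix.linftyOpNormedAlgebra
  Matrix.linftyOpNormedAddCommGroup Matrix.linftyOpNormedSpace

/-- The splitting of the matrix algebra into matrices commuting with a real diagonal matrix and
matrices supported at the entries where the diagonal entries differ. -/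
noncomputable def diagonalCommutantSplitting (c : ι → ℂ) (hc : star c = c) {d : ℕ}
    (e : Fin d ≃ {x : ι × ι // c x.1 ≠ c x.2}) :
    CommutantSplitting (Matrix.diagonal c) (EuclideanSpace ℝ (Fin d)) where
  p := LinearMap.toContinuousLinearMap
    { toFun := fun A => Matrix.of fun i j => if c i = c j then 0 else A i j
      map_add' := fun A B => by ext i j; by_cases h : c i = c j <;> simp [h]
      map_smul' := fun r A => by ext i j; by_cases h : c i = c j <;> simp [h] }
  q := LinearMap.toContinuousLinearMap
    { toFun := fun A => Matrix.of fun i j => if c i = c j then A i j else 0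
      map_add' := fun A B => by ext i j; by_cases h : c i = c j <;> simp [h]
      map_smul' := fun r A => by ext i j; by_cases h : c i = c j <;> simp [h] }
  isSelfAdjoint := by
    rw [Matrix.star_eq_conjTranspose, Matrix.diagonal_conjTranspose, hc]
  add_eq A := by ext i j; by_cases h : c i = c j <;> simp [h]
  p_q A := by ext i j; by_cases h : c i = c j <;> simp [h]
  p_star A := by
    ext i j; by_cases h : c i = c j <;> simp [h, Matrix.star_apply, eq_comm]
  q_star A := by
    ext i j; by_cases h : c i = c j <;> simp [h, Matrix.star_apply, eq_comm]
  commute A := by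
    rw [commute_diagonal_iff]
    intro i j h
    simp [h]
  deriv := LinearEquiv.toContinuousLinearEquiv
    { toFun := fun A => Matrix.of fun i j => (if c i = c j then 1 else c j - c i) * A i j
      invFun := fun A => Matrix.of fun i j => (if c i = c j then 1 else c j - c i)⁻¹ * A i j
      map_add' := fun A B => by ext i j; simp [mul_add]
      map_smul' := fun r A => by ext i j; simp [mul_left_comm]
      left_inv := fun A => by
        ext i j
        by_cases h : c i = c j
        · simp [h]
        · simp [h, inv_mul_cancel_left₀ (sub_ne_zero.2 (Ne.symm h))]
      right_inv := fun A => by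
        ext i j
        by_cases h : c i = c j
        · simp [h]
        · simp [h, mul_inv_cancel_left₀ (sub_ne_zero.2 (Ne.symm h))] }
  deriv_apply A := by
    ext i j
    by_cases h : c i = c j
    · simp [h]
    · simp [h]
      ring
  -- Using one real coordinate per ordered pair avoids choosing an order within each pair. The entry
  -- `(x_ij - x_ji) + (x_ij + x_ji) I` is automatically skew-Hermitian, and half of its real plus
  -- imaginary part recovers `x_ij`.
  param := LinearMap.toContinuousLinearMap
    { toFun := fun x => Matrix.of fun i j =>
        if h : c i = c j then 0 else
          ((x (e.symm ⟨(i, j), h⟩) - x (e.symm ⟨(j, i), Ne.symm h⟩) : ℝ) : ℂ) +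
          ((x (e.symm ⟨(i, j), h⟩) + x (e.symm ⟨(j, i), Ne.symm h⟩) : ℝ) : ℂ) * Complex.I
      map_add' := fun x y => by
        ext i j
        by_cases h : c i = c j
        · simp [h]
        · simp [h]
          ring
      map_smul' := fun r x => by
        ext i j
        by_cases h : c i = c j
        · simp [h]
        · simp [h]
          ring }
  coord := LinearMap.toContinuousLinearMap
    { toFun := fun A => WithLp.toLp 2 fun k =>
        ((A (e k).1.1 (e k).1.2).re + (A (e k).1.1 (e k).1.2).im) / 2
      map_add' := fun A B => by
        ext k
        simp
        ring
      map_smul' := fun r A => by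
        ext k
        simp
        ring }
  coord_param x := by
    ext k
    have h := (e k).2
    simp [h]
  p_param x := by
    ext i j
    by_cases h : c i = c j <;> simp [h]
  star_param x := by
    ext i j
    by_cases h : c i = c j
    · simp [h, Matrix.star_apply]
    · have h' : ¬ c j = c i := Ne.symm h
      simp [h, h', Matrix.star_apply]
      ring
  param_coord A hA hA' := by
    ext i j
    by_cases h : c i = c j
    · rw [← hA]
      simp [h]
    · have h1 : A j i = -star (A i j) := by
        have := congrFun (congrFun hA' j) i
        rw [Matrix.star_apply, Matrix.neg_apply] at this
        rw [this, neg_neg]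
      simp [h, h1]
      apply Complex.ext <;> simp <;> ring

/-- The quotient of `U(n)` by the stabilizer of a real diagonal matrix is a smooth manifold, whose
dimension is the number of pairs of distinct diagonal entries. -/
theorem isQuotientManifoldOfDim_of_commute_diagonal {n d : ℕ} (c : Fin n → ℂ) (hc : star c = c)
    (hd : Fintype.card {x : Fin n × Fin n // c x.1 ≠ c x.2} = d)
    (H : Subgroup (Matrix.unitaryGroup (Fin n) ℂ))
    (hH : ∀ u, u ∈ H ↔ Commute (u : Matrix (Fin n) (Fin n) ℂ) (Matrix.diagonal c)) :
    IsQuotientManifoldOfDim H d := by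
  have hemb : Topology.IsClosedEmbedding (conjMap (H := H) hH) := isClosedEmbedding_conjMap hH
  have hstar : ContinuousStar (Matrix (Fin n) (Fin n) ℂ) := inferInstance
  have : @ContinuousStar (Matrix (Fin n) (Fin n) ℂ)
    PseudoMetricSpace.toUniformSpace.toTopologicalSpace _ := hstar
  have : SecondCountableTopology (Matrix (Fin n) (Fin n) ℂ) :=
    inferInstanceAs (SecondCountableTopology (Fin n → Fin n → ℂ))
  obtain ⟨χ⟩ := (diagonalCommutantSplitting c hc
    (Fintype.equivFinOfCardEq hd).symm).nonempty_basePointChart (H := H)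
      (eventually_eq_diagonal_of_commute c) hH
  refine ⟨hemb.t2Space, hemb.isEmbedding.secondCountableTopology, χ.chartedSpace, χ.isManifold, ?_⟩
  intro f
  exact χ.contMDiff_iff_pullback f

end

end

/-! ### The block-diagonal subgroup as a stabilizer, and the dimension count -/

section

variable {n r : ℕ} {m : Fin r → ℕ} (h : ∑ i, m i = n)

/-- The block-diagonal indexing of `Fin n` by a decomposition `m₁ + ⋯ + m_r = n`. -/
def blockEquiv : (Σ i, Fin (m i)) ≃ Fin n := finSigmaFinEquiv.trans (finCongr h)

/-- The diagonal with constant value `lam i` on the `i`-th block. -/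
def blockConst (lam : Fin r → ℂ) (k : Fin n) : ℂ := lam ((blockEquiv h).symm k).1

/-- Since the values `lam i` are distinct, commuting with the block-constant diagonal kills exactly
the entries between different blocks. The diagonal blocks of such a unitary matrix are themselves
unitary. -/
theorem mem_range_blockUnitary_iff {lam : Fin r → ℂ} (hlam : Function.Injective lam)
    (U : Matrix.unitaryGroup (Fin n) ℂ) :
    U ∈ (blockUnitary m h).range ↔
      Commute (U : Matrix (Fin n) (Fin n) ℂ) (Matrix.diagonal (blockConst h lam)) := by
  rw [commute_diagonal_iff]
  constructor
  · rintro ⟨u, rfl⟩ k l hkl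
    change Matrix.blockDiagonal' (fun i => (u i : Matrix (Fin (m i)) (Fin (m i)) ℂ))
      ((blockEquiv h).symm k) ((blockEquiv h).symm l) = 0
    exact Matrix.blockDiagonal'_apply_ne _ _ _ fun hi => hkl (congrArg lam hi)
  · intro hU
    let B : ∀ i, Matrix (Fin (m i)) (Fin (m i)) ℂ := fun i =>
      Matrix.of fun a b => (U : Matrix (Fin n) (Fin n) ℂ) (blockEquiv h ⟨i, a⟩) (blockEquiv h ⟨i, b⟩)
    have hB : (U : Matrix (Fin n) (Fin n) ℂ).submatrix (blockEquiv h) (blockEquiv h) =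
        Matrix.blockDiagonal' B := by
      ext ⟨i, a⟩ ⟨j, b⟩
      by_cases hij : i = j
      · subst hij
        rw [Matrix.blockDiagonal'_apply_eq]
        rfl
      · rw [Matrix.blockDiagonal'_apply_ne _ _ _ hij]
        refine hU _ _ ?_
        simpa [blockConst] using hlam.ne hij
    have hBu : ∀ i, B i ∈ Matrix.unitaryGroup (Fin (m i)) ℂ := by
      have h1 : Matrix.blockDiagonal' (fun i => B i * (B i).conjTranspose) = 1 := by
        rw [Matrix.blockDiagonal'_mul, ← Matrix.blockDiagonal'_conjTranspose, ← hB,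
          Matrix.conjTranspose_submatrix, Matrix.submatrix_mul_equiv,
          ← Matrix.star_eq_conjTranspose, Matrix.mem_unitaryGroup_iff.1 U.2,
          Matrix.submatrix_one_equiv]
      rw [← Matrix.blockDiagonal'_one] at h1
      have h2 := Matrix.blockDiagonal'_injective h1
      exact fun i => Matrix.mem_unitaryGroup_iff.2 (congrFun h2 i)
    refine ⟨fun i => ⟨B i, hBu i⟩, Subtype.ext ?_⟩
    change Matrix.reindex (blockEquiv h) (blockEquiv h) (Matrix.blockDiagonal' B) = U
    rw [← hB, Matrix.reindex_apply, Matrix.submatrix_submatrix, Equiv.self_comp_symm,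
      Matrix.submatrix_id_id]

theorem card_blockConst_eq {lam : Fin r → ℂ} (hlam : Function.Injective lam) :
    Fintype.card {x : Fin n × Fin n // blockConst h lam x.1 = blockConst h lam x.2} =
      ∑ i, m i ^ 2 := by
  let e₁ : {x : Fin n × Fin n // blockConst h lam x.1 = blockConst h lam x.2} ≃
      {y : (Σ i, Fin (m i)) × (Σ i, Fin (m i)) // y.1.1 = y.2.1} :=
    ((blockEquiv h).symm.prodCongr (blockEquiv h).symm).subtypeEquiv fun x => hlam.eq_iff
  let e₂ : {y : (Σ i, Fin (m i)) × (Σ i, Fin (m i)) // y.1.1 = y.2.1} ≃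
      Σ i, Fin (m i) × Fin (m i) :=
    { toFun := fun y => ⟨y.1.1.1, y.1.1.2, Fin.cast (congrArg m y.2).symm y.1.2.2⟩
      invFun := fun z => ⟨(⟨z.1, z.2.1⟩, ⟨z.1, z.2.2⟩), rfl⟩
      left_inv := by
        rintro ⟨⟨⟨i, a⟩, ⟨j, b⟩⟩, rfl : i = j⟩
        rfl
      right_inv := fun _ => rfl }
  rw [Fintype.card_congr (e₁.trans e₂), Fintype.card_sigma]
  simp [sq]

theorem card_blockConst_ne {lam : Fin r → ℂ} (hlam : Function.Injective lam) :
    (Fintype.card {x : Fin n × Fin n // blockConst h lam x.1 ≠ blockConst h lam x.2} : ℤ) =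
      (n : ℤ) ^ 2 - ∑ i, (m i : ℤ) ^ 2 := by
  have h1 := Fintype.card_subtype_compl
    fun x : Fin n × Fin n => blockConst h lam x.1 = blockConst h lam x.2
  have h2 := Fintype.card_subtype_le
    fun x : Fin n × Fin n => blockConst h lam x.1 = blockConst h lam x.2
  rw [card_blockConst_eq h hlam] at h1 h2
  rw [Fintype.card_prod, Fintype.card_fin] at h1 h2
  simp only [ne_eq]
  rw [h1, Nat.cast_sub h2]
  push_cast
  ring

end

/-! ### Spectral theorem and multiplicities -/

/-- The geometric multiplicity of an eigenvalue of a Hermitian matrix is its multiplicity in the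
list of eigenvalues. -/
theorem Matrix.IsHermitian.finrank_eigenspace_toLin' {ι : Type*} [Fintype ι] [DecidableEq ι]
    {A : Matrix ι ι ℂ} (hA : A.IsHermitian) (μ : ℂ) :
    Module.finrank ℂ (Module.End.eigenspace (Matrix.toLin' A) μ) =
      Fintype.card {k // (hA.eigenvalues k : ℂ) = μ} := by
  have h1 : Module.End.eigenspace (Matrix.toLin' A) μ =
      LinearMap.ker (Matrix.toLin' (A - algebraMap ℂ _ μ)) := by
    ext x
    rw [Module.End.mem_eigenspace_iff, LinearMap.mem_ker, Matrix.toLin'_apply, Matrix.toLin'_apply,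
      Matrix.sub_mulVec, sub_eq_zero, Algebra.algebraMap_eq_smul_one, Matrix.smul_mulVec,
      Matrix.one_mulVec]
  -- Unitary diagonalization turns the rank of `A - μ` into the number of eigenvalues different from
  -- `μ`; rank-nullity then gives the kernel.
  have h2 : A - algebraMap ℂ _ μ = Unitary.conjStarAlgAut ℂ _ hA.eigenvectorUnitary
      (Matrix.diagonal fun k => (hA.eigenvalues k : ℂ) - μ) := by
    have h3 : (Matrix.diagonal fun k => (hA.eigenvalues k : ℂ) - μ) =
        Matrix.diagonal (RCLike.ofReal ∘ hA.eigenvalues) - algebraMap ℂ _ μ := by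
      rw [Matrix.algebraMap_eq_diagonal, Matrix.diagonal_sub]
      rfl
    rw [h3, map_sub, ← hA.spectral_theorem, AlgHomClass.commutes]
  have h4 : (A - algebraMap ℂ _ μ).rank =
      Fintype.card {k // (hA.eigenvalues k : ℂ) - μ ≠ 0} := by
    rw [h2, Unitary.conjStarAlgAut_apply, ← Unitary.coe_star,
      Matrix.rank_mul_eq_left_of_isUnit_det _ _ (Matrix.UnitaryGroup.det_isUnit _),
      Matrix.rank_mul_eq_right_of_isUnit_det _ _ (Matrix.UnitaryGroup.det_isUnit _),
      Matrix.rank_diagonal]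
  have h5 := LinearMap.finrank_range_add_finrank_ker (Matrix.toLin' (A - algebraMap ℂ _ μ))
  rw [← h1, Module.finrank_fintype_fun_eq_card] at h5
  have h6 : Module.finrank ℂ (LinearMap.range (Matrix.toLin' (A - algebraMap ℂ _ μ))) =
      Fintype.card {k // ¬ (hA.eigenvalues k : ℂ) = μ} := by
    rw [Matrix.toLin'_apply']
    simp only [sub_ne_zero] at h4
    exact h4
  rw [h6, Fintype.card_subtype_compl] at h5
  have h7 := Fintype.card_subtype_le fun k => (hA.eigenvalues k : ℂ) = μ
  omega

/-- A density matrix is unitarily conjugate to the diagonal matrix of its eigenvalues, repeated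
according to their geometric multiplicities. -/
theorem DensityMatrix.exists_eq_conj_diagonal {n r : ℕ} (ρ : DensityMatrix n) (lam : Fin r → ℂ)
    (m : Fin r → ℕ) (hlam : Function.Injective lam)
    (hspec : ∀ μ : ℂ,
      Module.End.HasEigenvalue (Matrix.toLin' ρ.toMatrix) μ ↔ ∃ i, lam i = μ)
    (hm : ∀ i, m i =
      Module.finrank ℂ (Module.End.eigenspace (Matrix.toLin' ρ.toMatrix) (lam i))) :
    ∃ h : ∑ i, m i = n, star (blockConst h lam) = blockConst h lam ∧
      ∃ g : Matrix.unitaryGroup (Fin n) ℂ,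
        ρ.toMatrix = g * Matrix.diagonal (blockConst h lam) * star (g : Matrix (Fin n) (Fin n) ℂ) := by
  have hA : ρ.toMatrix.IsHermitian := ρ.2.1.1
  have hf : ∀ k, ∃ i, lam i = (hA.eigenvalues k : ℂ) := by
    intro k
    rw [← hspec, Module.End.hasEigenvalue_iff, ← Submodule.one_le_finrank_iff, hA.finrank_eigenspace_toLin']
    exact Fintype.card_pos_iff.2 ⟨⟨k, rfl⟩⟩
  choose f hf using hf
  have hcard : ∀ i, Fintype.card {k // f k = i} = m i := by
    intro i
    rw [hm, hA.finrank_eigenspace_toLin']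
    refine Fintype.card_congr (Equiv.subtypeEquivRight fun k => ?_)
    rw [← hf, hlam.eq_iff]
  -- The fibres of `f` group the eigenvalue list by value; `σ` below is the resulting permutation,
  -- and it reorders the eigenvector columns block by block.
  let τ : (Σ i, Fin (m i)) ≃ Fin n :=
    (Equiv.sigmaCongrRight fun i => (Fintype.equivFinOfCardEq (hcard i)).symm).trans
      (Equiv.sigmaFiberEquiv f)
  have hτ : ∀ x, f (τ x) = x.1 := fun x =>
    ((Fintype.equivFinOfCardEq (hcard x.1)).symm x.2).2
  have h : ∑ i, m i = n := by
    have := Fintype.card_congr τ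
    simpa using this
  let σ : Fin n ≃ Fin n := (blockEquiv h).symm.trans τ
  have hσ : ∀ k, blockConst h lam k = (hA.eigenvalues (σ k) : ℂ) := by
    intro k
    rw [← hf]
    exact congrArg lam (hτ _).symm
  refine ⟨h, ?_, ?_⟩
  · ext k
    rw [Pi.star_apply, hσ]
    exact Complex.conj_ofReal _
  · let V : Matrix (Fin n) (Fin n) ℂ := hA.eigenvectorUnitary
    have hV : V * V.conjTranspose = 1 := Matrix.mem_unitaryGroup_iff.1 hA.eigenvectorUnitary.2
    refine ⟨⟨V.submatrix id σ, ?_⟩, ?_⟩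
    · rw [Matrix.mem_unitaryGroup_iff, Matrix.star_eq_conjTranspose,
        Matrix.conjTranspose_submatrix, Matrix.submatrix_mul_equiv, hV, Matrix.submatrix_id_id]
    · have hd : Matrix.diagonal (blockConst h lam) =
          (Matrix.diagonal (RCLike.ofReal ∘ hA.eigenvalues) : Matrix (Fin n) (Fin n) ℂ).submatrix
            σ σ := by
        rw [Matrix.submatrix_diagonal_equiv]
        congr 1
        ext k
        exact hσ k
      change _ = V.submatrix id σ * _ * (V.submatrix id σ).conjTranspose
      rw [hd, Matrix.conjTranspose_submatrix,
        Matrix.submatrix_mul_equiv, Matrix.submatrix_mul_equiv, Matrix.submatrix_id_id]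
      conv_lhs => rw [hA.spectral_theorem]
      rfl

/-! ### The orbit and the flag manifold -/

theorem theorem1 (n r : ℕ) (ρ : DensityMatrix n) (lam : Fin r → ℂ) (m : Fin r → ℕ)
    (hlam : Function.Injective lam)
    (hspec : ∀ μ : ℂ,
      Module.End.HasEigenvalue (Matrix.toLin' ρ.toMatrix) μ ↔ ∃ i, lam i = μ)
    (hm : ∀ i, m i =
      Module.finrank ℂ (Module.End.eigenspace (Matrix.toLin' ρ.toMatrix) (lam i))) :
    ∃ h : ∑ i, m i = n,
      Nonempty (MulAction.orbit (Matrix.unitaryGroup (Fin n) ℂ) ρ ≃ₜ FlagManifold m h) ∧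
      ∃ d : ℕ, (d : ℤ) = (n : ℤ) ^ 2 - ∑ i, (m i : ℤ) ^ 2 ∧
        IsQuotientManifoldOfDim (blockUnitary m h).range d := by
  obtain ⟨h, hstar, g, hg⟩ := ρ.exists_eq_conj_diagonal lam m hlam hspec hm
  have hH := mem_range_blockUnitary_iff h hlam
  refine ⟨h, ?_, _, card_blockConst_ne h hlam,
    isQuotientManifoldOfDim_of_commute_diagonal _ hstar rfl _ hH⟩
  have hconj : Topology.IsClosedEmbedding (conjMap (H := (blockUnitary m h).range) hH) :=
    isClosedEmbedding_conjMap hH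
  have hval : Topology.IsEmbedding
      fun x : MulAction.orbit (Matrix.unitaryGroup (Fin n) ℂ) ρ => (x : DensityMatrix n).toMatrix :=
    Topology.IsEmbedding.subtypeVal.comp Topology.IsEmbedding.subtypeVal
  have hsmul : ∀ U : Matrix.unitaryGroup (Fin n) ℂ, (U • ρ).toMatrix =
      ((U * g : Matrix.unitaryGroup (Fin n) ℂ) : Matrix (Fin n) (Fin n) ℂ) *
        Matrix.diagonal (blockConst h lam) *
        star ((U * g : Matrix.unitaryGroup (Fin n) ℂ) : Matrix (Fin n) (Fin n) ℂ) := by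
    intro U
    change (U : Matrix (Fin n) (Fin n) ℂ) * ρ.toMatrix * star (U : Matrix (Fin n) (Fin n) ℂ) = _
    rw [hg, Submonoid.coe_mul, star_mul]
    simp only [mul_assoc]
  -- Translating by `g` on the right identifies the orbit of `ρ` with that of the diagonal matrix.
  -- Two embeddings into matrices with the same range have homeomorphic domains.
  have hrange : Set.range (fun x : MulAction.orbit (Matrix.unitaryGroup (Fin n) ℂ) ρ =>
      (x : DensityMatrix n).toMatrix) = Set.range (conjMap (H := (blockUnitary m h).range) hH) := by
    ext X
    constructor
    · rintro ⟨⟨_, U, rfl⟩, rfl⟩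
      exact ⟨QuotientGroup.mk (U * g), (hsmul U).symm⟩
    · rintro ⟨q, rfl⟩
      obtain ⟨u, rfl⟩ := QuotientGroup.mk_surjective q
      refine ⟨⟨(u * g⁻¹) • ρ, u * g⁻¹, rfl⟩, ?_⟩
      change ((u * g⁻¹) • ρ).toMatrix = _
      rw [hsmul, inv_mul_cancel_right]
      rfl
  exact ⟨(hval.toHomeomorph.trans (Homeomorph.setCongr hrange)).trans
    hconj.isEmbedding.toHomeomorph.symm⟩
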